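/- For a finite simple graph $G$ and $S\subseteq V(G)$ let $B(S)$ be the set of vertices outside $S$ that have a neighbour in $S$. The boundary polynomial of $G$ is $B(G;x,y)=\sum_{S\subseteq V(G)}x^{|B(S)|}y^{|S|}=\sum_{i,j}B_{i,j}(G)\,x^iy^j$, so that $B_{i,j}(G)$ is the number of $S\subseteq V(G)$ with $|B(S)|=i$ and $|S|=j$. Let $F$ be a planar vector field with $F(0)=0$ whose linearization at the origin has a pair of nonzero purely imaginary eigenvalues (the origin is then called a weak focus in the broad sense, which does not exclude a center). For small $s\neq 0$ let $(P(s),0)$ be the first point at which the trajectory of $F$ starting at $(s,0)$ returns, at a positive time, to the open half of the $x$-axis containing $(s,0)$; put $P(0)=0$ and $d(s)=P(s)-s$. If $P$ is well defined and of class $C^3$ near $0$ and $d(0)=d'(0)=d''(0)=0$, the number $\sigma=d'''(0)$ is called the Liapunov number of $F$ at the origin. **Proposition 3.3.** Let $G_1,G_2$ be finite simple graphs of order at least $2$ with no isolated vertices. For $\alpha=0$, the system $$x'=\alpha x-y+B(G_1;x,y)-1,\qquad y'=x+\alpha y+B(G_2;x,y)-1$$ has an equilibrium at the origin with a pair of nonzero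 purely imaginary eigenvalues, and its Liapunov number there exists and is $$\sigma_B=\frac{3\pi}{2}\Big(3B_{0,3}(G_2)+B_{1,2}(G_1)+B_{2,1}(G_2)+2B_{0,2}(G_1)B_{0,2}(G_2)+B_{1,1}(G_1)B_{0,2}(G_1)-B_{1,1}(G_2)B_{0,2}(G_2)\Big).$$ -/

import Mathlib

open Filter Topology

open scoped Classical in
/-- The boundary of a set `S` of vertices: the vertices outside `S` that have a neighbour
in `S`. -/
noncomputable def graphBoundary {V : Type*} [Fintype V] (G : SimpleGraph V) (S : Finset V) :
    Finset V :=
  {v | v ∉ S ∧ ∃ u ∈ S, G.Adj u v}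

/-- The boundary polynomial `B(G; x, y) = ∑_S x ^ |∂S| * y ^ |S|`, as a real function. -/
noncomputable def boundaryPoly {V : Type*} [Fintype V] (G : SimpleGraph V) (x y : ℝ) : ℝ :=
  ∑ S : Finset V, x ^ (graphBoundary G S).card * y ^ S.card

open scoped Classical in
/-- The coefficient `B_{i,j}(G)`: the number of vertex sets `S` with `|∂S| = i`, `|S| = j`. -/
noncomputable def boundaryCoeff {V : Type*} [Fintype V] (G : SimpleGraph V) (i j : ℕ) : ℕ :=
  ({S : Finset V | (graphBoundary G S).card = i ∧ S.card = j} : Finset (Finset V)).card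

/-- The vector field `(αx - y + B(G₁; x, y) - 1, x + αy + B(G₂; x, y) - 1)`. -/
noncomputable def graphField {V₁ V₂ : Type*} [Fintype V₁] [Fintype V₂]
    (G₁ : SimpleGraph V₁) (G₂ : SimpleGraph V₂) (α : ℝ) (z : ℝ × ℝ) : ℝ × ℝ :=
  (α * z.1 - z.2 + boundaryPoly G₁ z.1 z.2 - 1, z.1 + α * z.2 + boundaryPoly G₂ z.1 z.2 - 1)

/-- The trajectory of `z' = F z` that starts at `(s, 0)` meets the open half of the `x`-axis
that contains `(s, 0)` again at some positive time, for the first time at the point `(p, 0)`. -/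
def IsFirstReturn (F : ℝ × ℝ → ℝ × ℝ) (s p : ℝ) : Prop :=
  ∃ (T : ℝ) (γ : ℝ → ℝ × ℝ), 0 < T ∧ IsIntegralCurveOn γ (fun _ => F) (Set.Icc 0 T) ∧
    γ 0 = (s, 0) ∧ γ T = (p, 0) ∧ 0 < s * p ∧
    ∀ t ∈ Set.Ioo 0 T, ¬ (0 < s * (γ t).1 ∧ (γ t).2 = 0)

open scoped Classical in
/-- The Poincaré map of `F` around the origin, with the `x`-axis as transversal; it sends `0`
to `0`, because `IsFirstReturn F 0 p` never holds. -/
noncomputable def poincareMap (F : ℝ × ℝ → ℝ × ℝ) (s : ℝ) : ℝ :=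
  if h : ∃ p, IsFirstReturn F s p then h.choose else 0

/-- The displacement function `d(s) = P(s) - s`. -/
noncomputable def displacement (F : ℝ × ℝ → ℝ × ℝ) (s : ℝ) : ℝ :=
  poincareMap F s - s

/-- The origin is an equilibrium whose linearization is a center: the trace is zero and the
determinant positive, so that the eigenvalues are a pair `± i ω` with `ω > 0`. -/
structure IsLinearCenter (F : ℝ × ℝ → ℝ × ℝ) : Prop where
  equilibrium : F 0 = 0
  differentiableAt : DifferentiableAt ℝ F 0
  trace_eq_zero : LinearMap.trace ℝ (ℝ × ℝ) (fderiv ℝ F 0 : ℝ × ℝ →ₗ[ℝ] ℝ × ℝ) = 0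
  det_pos : 0 < LinearMap.det (fderiv ℝ F 0 : ℝ × ℝ →ₗ[ℝ] ℝ × ℝ)

/-- The Liapunov number of `F` at the origin is `σ = d'''(0)`. The other fields say that
`d'''(0)` has its proper meaning: the linearization is a center, the Poincaré map is
well defined and of class `C³` near the origin, and `d(0) = d'(0) = d''(0) = 0`. -/
structure HasLiapunovNumber (F : ℝ × ℝ → ℝ × ℝ) (σ : ℝ) : Prop where
  linearCenter : IsLinearCenter F
  existsUnique_return : ∀ᶠ s in 𝓝[≠] (0 : ℝ), ∃! p, IsFirstReturn F s p
  contDiffAt : ContDiffAt ℝ 3 (poincareMap F) 0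
  displacement_zero : displacement F 0 = 0
  deriv_zero : deriv (displacement F) 0 = 0
  deriv_two_zero : iteratedDeriv 2 (displacement F) 0 = 0
  deriv_three : iteratedDeriv 3 (displacement F) 0 = σ

/-! ### The radial equation as a fixed-point problem in a commutative Banach algebra. -/

section BanachAlgebra

open Asymptotics Polynomial

variable {A : Type*} [NormedCommRing A] [NormedAlgebra ℝ A]

/-! Without isolated vertices `B(Gᵢ; x, y) - 1` has only terms of degree at least 2, so in polar
coordinates the field reads `r' = r² G`, `θ' = 1 + r H`. An orbit near the origin is then a graph `r
= u(θ)` with `u = s + ∫ u² G(u) / (1 + u H(u)) dθ`, and the return map is `P(s) = u(2π)`.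

This integral equation is solved in the Banach algebra of continuous functions on `[0, 2π]`. The
integrand has zero derivative at `u = 0`, so the inverse function theorem gives a solution depending
smoothly on `s` (`exists_smooth_radial_solution`). Iterating the equation yields `u = s + s² I g₀ +
s³ I (2 g₀ I g₀ + g₁ - g₀ h₀) + O(s⁴)` (`radial_solution_expansion`), where `I` is integration from
angle 0. `isFirstReturn_of_radial_solution` and `IsFirstReturn.unique` identify `u(2π)` with the
first return.

At `2π` the term `I (2 g₀ I g₀)` equals `(I g₀)²`, and `I g₀` vanishes there because `g₀` is a cubic
trigonometric form. Quartic and sextic integrals give the rest as `π / 4` times the bracket in the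
theorem; `d'''(0)` is `3!` times that. -/

/-- The radial right-hand side `u² G(u) / (1 + u H(u))` over a commutative Banach algebra. -/
noncomputable def radialField (G H : A[X]) (u : A) : A :=
  u ^ 2 * (G.eval u * Ring.inverse (1 + u * H.eval u))

lemma contDiff_polynomial_eval (G : A[X]) {n : WithTop ℕ∞} : ContDiff ℝ n fun u : A => G.eval u := by
  simp only [Polynomial.eval_eq_sum, Polynomial.sum]
  fun_prop

variable [CompleteSpace A]

/-- At `u = 0` the argument is the unit `1`, and inversion is smooth at units. -/
lemma contDiffAt_inverse_one_add (H : A[X]) {n : WithTop ℕ∞} :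
    ContDiffAt ℝ n (fun u : A => Ring.inverse (1 + u * H.eval u)) 0 := by
  have h1 : ContDiffAt ℝ n (fun u : A => 1 + u * H.eval u) 0 :=
    (contDiff_const.add (contDiff_id.mul (contDiff_polynomial_eval H))).contDiffAt
  have h2 : ContDiffAt ℝ n (Ring.inverse : A → A) ((fun u : A => 1 + u * H.eval u) 0) := by
    simpa using contDiffAt_ringInverse ℝ (1 : Aˣ)
  exact h2.comp (0 : A) h1

lemma contDiffAt_radialField (G H : A[X]) {n : WithTop ℕ∞} :
    ContDiffAt ℝ n (radialField G H) 0 :=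
  (contDiff_id.pow 2).contDiffAt.mul
    ((contDiff_polynomial_eval G).contDiffAt.mul (contDiffAt_inverse_one_add H))

/-- The factor `u ^ 2` kills the linear part. This makes the fixed-point map a perturbation of the
identity and later gives `u s = s + o(s)`. -/
lemma hasFDerivAt_radialField (G H : A[X]) : HasFDerivAt (radialField G H) (0 : A →L[ℝ] A) 0 := by
  have h1 : DifferentiableAt ℝ (fun u : A => G.eval u * Ring.inverse (1 + u * H.eval u)) 0 :=
    ((contDiff_polynomial_eval G).contDiffAt.mul
      (contDiffAt_inverse_one_add (n := 1) H)).differentiableAt one_ne_zero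
  have h2 : HasFDerivAt (fun u : A => u ^ 2) (0 : A →L[ℝ] A) 0 := by
    have := (hasFDerivAt_id (𝕜 := ℝ) (0 : A)).pow 2
    simpa using this
  have := h2.mul h1.hasFDerivAt
  simpa [radialField] using! this

/-- The fixed points `u = s + I(u² G(u) / (1 + u H(u)))` form a smooth curve near `s = 0`. -/
lemma exists_smooth_radial_solution (G H : A[X]) (I : A →L[ℝ] A) {n : WithTop ℕ∞} (hn : n ≠ 0) :
    ∃ u : ℝ → A, ContDiffAt ℝ n u 0 ∧ u 0 = 0 ∧
      ∀ᶠ s in 𝓝 (0 : ℝ), u s = s • (1 : A) + I (radialField G H (u s)) := by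
  set Ψ : A → A := fun u => u - I (radialField G H u) with hΨ
  have hc : ContDiffAt ℝ n Ψ 0 :=
    contDiffAt_id.sub (I.contDiff.contDiffAt.comp (0 : A) (contDiffAt_radialField G H))
  have hd : HasFDerivAt Ψ ((ContinuousLinearEquiv.refl ℝ A : A ≃L[ℝ] A) : A →L[ℝ] A) 0 := by
    have := (hasFDerivAt_id (𝕜 := ℝ) (0 : A)).sub
      (I.hasFDerivAt.comp (0 : A) (hasFDerivAt_radialField G H))
    convert! this using 1
    simp
  have h0 : Ψ 0 = 0 := by simp [hΨ, radialField]
  have hinv := hc.to_localInverse hd hn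
  have hinv0 := hc.localInverse_apply_image hd hn
  rw [h0] at hinv hinv0
  have hev := (hc.hasStrictFDerivAt' hd hn).eventually_right_inverse
  rw [h0] at hev
  have hl : ContDiff ℝ n (fun s : ℝ => s • (1 : A)) := contDiff_id.smul contDiff_const
  have hl0 : Tendsto (fun s : ℝ => s • (1 : A)) (𝓝 0) (𝓝 0) := by
    have := hl.continuous.tendsto 0
    simpa using this
  refine ⟨fun s => hc.localInverse hd hn (s • (1 : A)), ?_, by simpa using hinv0, ?_⟩
  · have : ContDiffAt ℝ n (hc.localInverse hd hn) ((fun s : ℝ => s • (1 : A)) 0) := by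
      simpa using hinv
    exact this.comp (0 : ℝ) hl.contDiffAt
  · filter_upwards [hl0.eventually hev] with s hs
    have : Ψ (hc.localInverse hd hn (s • (1 : A))) = s • (1 : A) := hs
    exact sub_eq_iff_eq_add.1 this

/-- Second order expansion of the radial right-hand side at `0`. -/
lemma radialField_sub_isBigO (G H : A[X]) :
    (fun u : A => radialField G H u
      - (u ^ 2 * G.coeff 0 + u ^ 3 * (G.coeff 1 - G.coeff 0 * H.coeff 0)))
      =O[𝓝 0] fun u => ‖u‖ ^ 4 := by
  set g0 := G.coeff 0
  set g1 := G.coeff 1 - G.coeff 0 * H.coeff 0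
  set h0 := H.coeff 0
  have hunit : ∀ᶠ u : A in 𝓝 0, IsUnit (1 + u * H.eval u) := by
    have hcont : ContinuousAt (fun u : A => 1 + u * H.eval u) 0 :=
      (contDiff_const.add (contDiff_id.mul
        (contDiff_polynomial_eval (n := 0) H))).continuous.continuousAt
    have : {x : A | IsUnit x} ∈ 𝓝 ((fun u : A => 1 + u * H.eval u) 0) := by
      simpa using Units.isOpen.mem_nhds (show IsUnit (1 : A) from isUnit_one)
    exact hcont this
  -- `g0 + g1 X` is `G / (1 + X H)` modulo `X ^ 2`; multiplying out the denominator turns this into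
  -- divisibility of polynomials.
  obtain ⟨q, hq⟩ : ∃ q : A[X],
      G - (C g0 + C g1 * X) * (1 + X * H) = X ^ 2 * q := by
    have e : G - (C g0 + C g1 * X) * (1 + X * H)
        = G - C g0 - X * (C g1 + C g0 * H + X * (C g1 * H)) := by ring
    rw [e]
    refine X_pow_dvd_iff.2 fun d hd => ?_
    interval_cases d
    · simp [g0, mul_coeff_zero]
    · have := coeff_X_mul (C g1 + C g0 * H + X * (C g1 * H)) 0
      rw [zero_add] at this
      rw [coeff_sub, this]
      simp [g1, g0, mul_coeff_zero, coeff_C]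
  have hb : (fun u : A => q.eval u * Ring.inverse (1 + u * H.eval u)) =O[𝓝 0]
      fun _ => (1 : ℝ) := by
    have : ContinuousAt (fun u : A => q.eval u * Ring.inverse (1 + u * H.eval u)) 0 :=
      ((contDiff_polynomial_eval q).contDiffAt.mul
        (contDiffAt_inverse_one_add (n := 0) H)).continuousAt
    exact this.isBigO_one ℝ
  have hid : (fun u : A => u) =O[𝓝 0] fun u => ‖u‖ := (isBigO_refl _ _).norm_right
  have h4 : (fun u : A => u ^ 4 * (q.eval u * Ring.inverse (1 + u * H.eval u))) =O[𝓝 0]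
      fun u => ‖u‖ ^ 4 := by
    simpa using (hid.pow 4).mul hb
  refine h4.congr' ?_ EventuallyEq.rfl
  filter_upwards [hunit] with u hu
  have e := congrArg (Polynomial.eval u) hq
  simp only [eval_sub, eval_mul, eval_add, eval_C, eval_X, eval_one, eval_pow] at e
  have hi := Ring.mul_inverse_cancel _ hu
  rw [radialField]
  linear_combination (-u ^ 2 * Ring.inverse (1 + u * H.eval u)) * e
    - u ^ 2 * (g0 + g1 * u) * hi

/-- Third order expansion in the initial value of the solution of the integral equation. -/
lemma radial_solution_expansion (G H : A[X]) (I : A →L[ℝ] A) {u : ℝ → A}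
    (hu : DifferentiableAt ℝ u 0) (hu0 : u 0 = 0)
    (hfix : ∀ᶠ s in 𝓝 (0 : ℝ), u s = s • (1 : A) + I (radialField G H (u s))) :
    (fun s : ℝ => u s - (s • (1 : A) + s ^ 2 • I (G.coeff 0)
      + s ^ 3 • I (2 * G.coeff 0 * I (G.coeff 0) + (G.coeff 1 - G.coeff 0 * H.coeff 0))))
      =O[𝓝 0] fun s => s ^ 4 := by
  set g0 := G.coeff 0
  set g1 := G.coeff 1 - G.coeff 0 * H.coeff 0
  set J := I g0
  have ut : Tendsto u (𝓝 0) (𝓝 0) := by simpa [hu0] using hu.continuousAt.tendsto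
  have o1 : u =O[𝓝 0] fun s : ℝ => s := by
    simpa [hu0] using hu.hasFDerivAt.isBigO_sub
  have lin : (fun s : ℝ => s • (1 : A)) =O[𝓝 0] fun s : ℝ => s :=
    IsBigO.of_bound ‖(1 : A)‖ (Eventually.of_forall fun s => by
      rw [norm_smul, mul_comm])
  have hpow : ∀ {m n : ℕ}, n ≤ m → (fun s : ℝ => s ^ m) =O[𝓝 0] fun s : ℝ => s ^ n := by
    intro m n hmn
    refine IsBigO.of_bound 1 ?_
    filter_upwards [Metric.ball_mem_nhds (0 : ℝ) one_pos] with s hs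
    rw [one_mul, norm_pow, norm_pow]
    exact pow_le_pow_of_le_one (norm_nonneg _) (mem_ball_zero_iff.1 hs).le hmn
  have hsm : ∀ (n : ℕ) (a : A), (fun s : ℝ => s ^ n • a) =O[𝓝 0] fun s : ℝ => s ^ n :=
    fun n a => IsBigO.of_bound ‖a‖ (Eventually.of_forall fun s => by
      rw [norm_smul, mul_comm])
  have hcst : ∀ a : A, (fun _ : ℝ => a) =O[𝓝 0] fun _ : ℝ => (1 : ℝ) :=
    fun a => isBigO_const_const a one_ne_zero _
  -- the remainder of the right-hand side along the solution
  have R4 : (fun s => radialField G H (u s) - (u s ^ 2 * g0 + u s ^ 3 * g1))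
      =O[𝓝 0] fun s : ℝ => s ^ 4 :=
    ((radialField_sub_isBigO G H).comp_tendsto ut).trans (o1.norm_left.pow 4)
  have q2 : (fun s => u s ^ 2) =O[𝓝 0] fun s : ℝ => s ^ 2 := o1.pow 2
  have q3 : (fun s => u s ^ 3) =O[𝓝 0] fun s : ℝ => s ^ 3 := o1.pow 3
  have c3 : (fun s => u s ^ 3 * g1) =O[𝓝 0] fun s : ℝ => s ^ 3 := by
    simpa using q3.mul (hcst g1)
  -- first order
  have e1 : (fun s => u s - s • (1 : A)) =O[𝓝 0] fun s : ℝ => s ^ 2 := by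
    have : (fun s => radialField G H (u s)) =O[𝓝 0] fun s : ℝ => s ^ 2 := by
      have a1 : (fun s => u s ^ 2 * g0) =O[𝓝 0] fun s : ℝ => s ^ 2 := by
        simpa using q2.mul (hcst g0)
      have := (R4.trans (hpow (by norm_num : 2 ≤ 4))).add
        (a1.add (c3.trans (hpow (by norm_num : 2 ≤ 3))))
      simpa using this
    refine ((I.isBigO_comp _ _).trans this).congr' ?_ EventuallyEq.rfl
    filter_upwards [hfix] with s hs
    rw [eq_comm, sub_eq_iff_eq_add']
    exact hs
  -- `u² - s² = (u - s)(u + s)`: the nonlinearity is quadratic, so each substitution into the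
  -- equation gains one order.
  have d2 : (fun s => u s ^ 2 - s ^ 2 • (1 : A)) =O[𝓝 0] fun s : ℝ => s ^ 3 := by
    have := e1.mul (o1.add lin)
    refine this.congr (fun s => ?_) (fun s => by ring)
    simp only [Algebra.smul_def, map_pow, mul_one]; ring
  have e2 : (fun s => u s - (s • (1 : A) + s ^ 2 • J)) =O[𝓝 0] fun s : ℝ => s ^ 3 := by
    have : (fun s => radialField G H (u s) - s ^ 2 • g0) =O[𝓝 0] fun s : ℝ => s ^ 3 := by
      have a1 : (fun s => (u s ^ 2 - s ^ 2 • (1 : A)) * g0) =O[𝓝 0] fun s : ℝ => s ^ 3 := by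
        simpa using d2.mul (hcst g0)
      refine ((R4.trans (hpow (by norm_num : 3 ≤ 4))).add (a1.add c3)).congr_left fun s => ?_
      simp only [Algebra.smul_def, map_pow, mul_one]; ring
    refine ((I.isBigO_comp _ _).trans this).congr' ?_ EventuallyEq.rfl
    filter_upwards [hfix] with s hs
    rw [map_sub, map_smul, eq_sub_of_add_eq' hs.symm]
    abel
  -- `u² - s² - 2 s³ J = (u - s - s² J)(u + s) + s² J (u - s)`.
  have d2' : (fun s => u s ^ 2 - (s ^ 2 • (1 : A) + s ^ 3 • (2 * J))) =O[𝓝 0]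
      fun s : ℝ => s ^ 4 := by
    have a1 := (e2.mul (o1.add lin)).congr_right
      (g₂ := fun s : ℝ => s ^ 4) (fun s => by ring)
    have a2 := ((hsm 2 J).mul e1).congr_right (g₂ := fun s : ℝ => s ^ 4) (fun s => by ring)
    refine (a1.add a2).congr_left fun s => ?_
    simp only [Algebra.smul_def, map_pow, mul_one]; ring
  have d3 : (fun s => u s ^ 3 - s ^ 3 • (1 : A)) =O[𝓝 0] fun s : ℝ => s ^ 4 := by
    have a1 := (d2.mul o1).congr_right (g₂ := fun s : ℝ => s ^ 4) (fun s => by ring)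
    have a2 := ((hsm 2 (1 : A)).mul e1).congr_right (g₂ := fun s : ℝ => s ^ 4)
      (fun s => by ring)
    refine (a1.add a2).congr_left fun s => ?_
    simp only [Algebra.smul_def, map_pow, mul_one]; ring
  have : (fun s => radialField G H (u s) - (s ^ 2 • g0 + s ^ 3 • (2 * g0 * J + g1)))
      =O[𝓝 0] fun s : ℝ => s ^ 4 := by
    have a1 : (fun s => (u s ^ 2 - (s ^ 2 • (1 : A) + s ^ 3 • (2 * J))) * g0) =O[𝓝 0]
        fun s : ℝ => s ^ 4 := by
      simpa using d2'.mul (hcst g0)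
    have a2 : (fun s => (u s ^ 3 - s ^ 3 • (1 : A)) * g1) =O[𝓝 0] fun s : ℝ => s ^ 4 := by
      simpa using d3.mul (hcst g1)
    refine (R4.add (a1.add a2)).congr_left fun s => ?_
    simp only [Algebra.smul_def, map_pow, mul_one]; ring
  refine ((I.isBigO_comp _ _).trans this).congr' ?_ EventuallyEq.rfl
  filter_upwards [hfix] with s hs
  rw [map_sub, map_add, map_smul, map_smul, eq_sub_of_add_eq' hs.symm]
  abel

end BanachAlgebra

/-! ### Polar angle functions and the first return of a trajectory. -/

section FirstReturn

open Polynomial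

/-- Continuous functions of the polar angle over one full turn. -/
abbrev AngleFun := C(Set.Icc (0 : ℝ) (2 * Real.pi), ℝ)

namespace AngleFun

/-- Extension of a function of the angle to the whole line, constant outside the interval. -/
noncomputable def extend (f : AngleFun) : ℝ → ℝ := Set.IccExtend Real.two_pi_pos.le f

lemma continuous_extend (f : AngleFun) : Continuous f.extend := f.continuous.Icc_extend'

lemma extend_coe (f : AngleFun) (θ : Set.Icc (0 : ℝ) (2 * Real.pi)) : f.extend θ = f θ :=
  Set.IccExtend_val _ _ _

lemma extend_of_mem (f : AngleFun) {θ : ℝ} (h : θ ∈ Set.Icc (0 : ℝ) (2 * Real.pi)) :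
    f.extend θ = f ⟨θ, h⟩ := f.extend_coe ⟨θ, h⟩

lemma abs_extend_le (f : AngleFun) (θ : ℝ) : |f.extend θ| ≤ ‖f‖ := f.norm_coe_le_norm _

/-- The primitive vanishing at `0`, on the whole line. -/
noncomputable def primitive (f : AngleFun) (θ : ℝ) : ℝ := ∫ x in (0 : ℝ)..θ, f.extend x

lemma primitive_zero (f : AngleFun) : f.primitive 0 = 0 := intervalIntegral.integral_same

lemma hasDerivAt_primitive (f : AngleFun) (θ : ℝ) : HasDerivAt f.primitive (f.extend θ) θ :=
  f.continuous_extend.integral_hasStrictDerivAt 0 θ |>.hasDerivAt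

lemma continuous_primitive (f : AngleFun) : Continuous f.primitive :=
  continuous_iff_continuousAt.2 fun θ => (f.hasDerivAt_primitive θ).continuousAt

/-- Integration from angle `0` as a bounded operator. -/
noncomputable def integralCLM : AngleFun →L[ℝ] AngleFun :=
  LinearMap.mkContinuous
    { toFun := fun f => ⟨fun θ => f.primitive θ, f.continuous_primitive.comp continuous_subtype_val⟩
      map_add' := fun f g => by
        ext θ
        exact intervalIntegral.integral_add (f.continuous_extend.intervalIntegrable _ _)
          (g.continuous_extend.intervalIntegrable _ _)
      map_smul' := fun c f => by
        ext θ
        exact intervalIntegral.integral_const_mul _ _ } (2 * Real.pi) (by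
    intro f
    rw [ContinuousMap.norm_le _ (by positivity)]
    rintro ⟨θ, h0, h1⟩
    have : ‖∫ x in (0 : ℝ)..θ, f.extend x‖ ≤ ‖f‖ * |θ - 0| :=
      intervalIntegral.norm_integral_le_of_norm_le_const fun x _ => f.abs_extend_le x
    rw [sub_zero, abs_of_nonneg h0] at this
    calc _ ≤ ‖f‖ * θ := this
      _ ≤ ‖f‖ * (2 * Real.pi) := by gcongr
      _ = _ := mul_comm _ _)

lemma integralCLM_apply (f : AngleFun) (θ : Set.Icc (0 : ℝ) (2 * Real.pi)) :
    integralCLM f θ = f.primitive θ := rfl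

/-- The cosine of the angle. -/
noncomputable def cos : AngleFun := ⟨fun θ => Real.cos θ, by fun_prop⟩

/-- The sine of the angle. -/
noncomputable def sin : AngleFun := ⟨fun θ => Real.sin θ, by fun_prop⟩

@[simp] lemma cos_apply (θ : Set.Icc (0 : ℝ) (2 * Real.pi)) : cos θ = Real.cos θ := rfl

@[simp] lemma sin_apply (θ : Set.Icc (0 : ℝ) (2 * Real.pi)) : sin θ = Real.sin θ := rfl

lemma inverse_apply {w : AngleFun} (hw : ∀ θ, w θ ≠ 0) (θ : Set.Icc (0 : ℝ) (2 * Real.pi)) :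
    Ring.inverse w θ = (w θ)⁻¹ := by
  have h := Ring.mul_inverse_cancel _ ((ContinuousMap.isUnit_iff_forall_ne_zero w).2 hw)
  have := DFunLike.congr_fun h θ
  exact eq_inv_of_mul_eq_one_right this

/-- A positive function has a primitive which is an increasing bijection of the line. -/
lemma exists_inverse_primitive (g : AngleFun) (hg : ∀ θ, 0 < g θ) :
    ∃ e : ℝ ≃o ℝ, (∀ θ, e θ = g.primitive θ) ∧
      ∀ t, HasDerivAt e.symm (g.extend (e.symm t))⁻¹ t := by
  have hpos : ∀ θ, 0 < g.extend θ := fun θ => hg _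
  have hmono : StrictMono g.primitive :=
    strictMono_of_hasDerivAt_pos g.hasDerivAt_primitive hpos
  -- The positive minimum of `g` bounds the slope of the primitive from below, which makes it
  -- unbounded in both directions.
  obtain ⟨x, -, hx⟩ := isCompact_univ.exists_isMinOn
    (s := (Set.univ : Set (Set.Icc (0 : ℝ) (2 * Real.pi))))
    ⟨⟨0, le_rfl, Real.two_pi_pos.le⟩, trivial⟩ g.continuous.continuousOn
  have hmin : ∀ θ, g x ≤ g.extend θ := fun θ => hx (Set.mem_univ _)
  have hm : Monotone fun θ => g.primitive θ - g x * θ :=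
    monotone_of_hasDerivAt_nonneg
      (fun θ => (g.hasDerivAt_primitive θ).sub ((hasDerivAt_id θ).const_mul (g x)))
      (fun θ => by simpa using hmin θ)
  have hsurj : Function.Surjective g.primitive := by
    refine g.continuous_primitive.surjective ?_ ?_
    · refine tendsto_atTop_mono' _ ?_ (tendsto_id.const_mul_atTop (hg x))
      filter_upwards [eventually_ge_atTop 0] with θ hθ
      have := hm hθ
      simpa [primitive_zero] using this
    · refine tendsto_atBot_mono' _ ?_ (tendsto_id.const_mul_atBot (hg x))
      filter_upwards [eventually_le_atBot 0] with θ hθ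
      have := hm hθ
      simpa [primitive_zero] using this
  refine ⟨hmono.orderIsoOfSurjective _ hsurj, fun _ => rfl, fun t => ?_⟩
  refine HasDerivAt.of_local_left_inverse
    (hmono.orderIsoOfSurjective _ hsurj).symm.continuous.continuousAt
    (g.hasDerivAt_primitive _) (hpos _).ne' (Eventually.of_forall fun y => ?_)
  exact (hmono.orderIsoOfSurjective _ hsurj).apply_symm_apply y

end AngleFun

/-- `F` is in polar coordinates `r' = r² (cos θ K₁ + sin θ K₂)`,
`θ' = 1 + r (cos θ K₂ - sin θ K₁)`, written in Cartesian components. -/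
def HasPolarForm (F : ℝ × ℝ → ℝ × ℝ) (K₁ K₂ : AngleFun[X]) : Prop :=
  ∀ (u : AngleFun) (θ : Set.Icc (0 : ℝ) (2 * Real.pi)),
    F (u θ * Real.cos θ, u θ * Real.sin θ)
      = (-(u θ * Real.sin θ) + u θ ^ 2 * K₁.eval u θ, u θ * Real.cos θ + u θ ^ 2 * K₂.eval u θ)

/-- The radial component of the nonlinearity. -/
noncomputable def radialPart (K₁ K₂ : AngleFun[X]) : AngleFun[X] :=
  C AngleFun.cos * K₁ + C AngleFun.sin * K₂

/-- The angular component of the nonlinearity. -/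
noncomputable def angularPart (K₁ K₂ : AngleFun[X]) : AngleFun[X] :=
  C AngleFun.cos * K₂ - C AngleFun.sin * K₁

/-- The angle at the end of a full turn. -/
noncomputable def fullTurn : Set.Icc (0 : ℝ) (2 * Real.pi) :=
  ⟨2 * Real.pi, Real.two_pi_pos.le, le_rfl⟩

/-- A solution `u(θ)` of the radial equation over a full turn gives the first return. -/
lemma isFirstReturn_of_radial_solution {F : ℝ × ℝ → ℝ × ℝ} {K₁ K₂ : AngleFun[X]}
    (hF : HasPolarForm F K₁ K₂) {s : ℝ} {u : AngleFun}
    (hu : u = s • (1 : AngleFun) + AngleFun.integralCLM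
      (radialField (radialPart K₁ K₂) (angularPart K₁ K₂) u))
    (hpos : ∀ θ, 0 < s * u θ) (hang : ∀ θ, 0 < 1 + u θ * (angularPart K₁ K₂).eval u θ) :
    IsFirstReturn F s (u fullTurn) := by
  set w : AngleFun := 1 + u * (angularPart K₁ K₂).eval u with hw
  have hwpos : ∀ θ, 0 < w θ := hang
  -- `w` is the angular speed along the orbit, so `g = dt/dθ`; its primitive `e` is time as a
  -- function of the angle, and `e.symm` is the angle as a function of time.
  set g : AngleFun := Ring.inverse w with hg
  have hgw : ∀ θ, g θ = (w θ)⁻¹ := AngleFun.inverse_apply fun θ => (hwpos θ).ne'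
  set f : AngleFun := radialField (radialPart K₁ K₂) (angularPart K₁ K₂) u with hf
  obtain ⟨e, he, hder⟩ := g.exists_inverse_primitive fun θ => by
    rw [hgw]; exact inv_pos.2 (hwpos θ)
  set r : ℝ → ℝ := fun θ => s + f.primitive θ with hr
  have hru : ∀ θ : Set.Icc (0 : ℝ) (2 * Real.pi), r θ = u θ := fun θ => by
    have := DFunLike.congr_fun hu θ
    rw [this]
    simp [hr, AngleFun.integralCLM_apply]
  have he0 : e 0 = 0 := by rw [he, AngleFun.primitive_zero]
  have hs0 : e.symm 0 = 0 := by rw [OrderIso.symm_apply_eq, he0]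
  set T := e (2 * Real.pi)
  have hsT : e.symm T = 2 * Real.pi := e.symm_apply_apply _
  have hr0 : r 0 = s := by simp [hr, AngleFun.primitive_zero]
  refine ⟨T, fun t => (r (e.symm t) * Real.cos (e.symm t), r (e.symm t) * Real.sin (e.symm t)),
    ?_, ?_, ?_, ?_, hpos _, ?_⟩
  · rw [← he0]
    exact e.strictMono Real.two_pi_pos
  · intro t ht
    have hmem : e.symm t ∈ Set.Icc (0 : ℝ) (2 * Real.pi) :=
      ⟨by rw [← hs0]; exact e.symm.monotone ht.1, by rw [← hsT]; exact e.symm.monotone ht.2⟩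
    obtain ⟨θ, hθ⟩ : ∃ θ : Set.Icc (0 : ℝ) (2 * Real.pi), (θ : ℝ) = e.symm t := ⟨⟨_, hmem⟩, rfl⟩
    have hϑ : HasDerivAt e.symm (w θ) t := by
      have := hder t
      rwa [← hθ, g.extend_coe, hgw, inv_inv] at this
    have hrd : HasDerivAt r (f θ) (e.symm t) := by
      have := (f.hasDerivAt_primitive (e.symm t)).const_add s
      rwa [← hθ, f.extend_coe, hθ] at this
    have hrt := hrd.comp t hϑ
    have hct := (Real.hasDerivAt_cos (e.symm t)).comp t hϑ
    have hst := (Real.hasDerivAt_sin (e.symm t)).comp t hϑ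
    have h1 := (hrt.mul hct).prodMk (hrt.mul hst)
    refine HasDerivAt.hasDerivWithinAt ?_
    convert! h1 using 1
    simp only [Function.comp_apply, ← hθ, hru]
    have hfw : f θ * w θ = u θ ^ 2 * (radialPart K₁ K₂).eval u θ := by
      have : f θ = u θ ^ 2 * ((radialPart K₁ K₂).eval u θ * g θ) := rfl
      rw [this, hgw]
      field_simp [(hwpos θ).ne']
    have hwθ : w θ = 1 + u θ * (angularPart K₁ K₂).eval u θ := rfl
    have hG : (radialPart K₁ K₂).eval u θ
        = Real.cos θ * K₁.eval u θ + Real.sin θ * K₂.eval u θ := by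
      simp [radialPart]
    have hH : (angularPart K₁ K₂).eval u θ
        = Real.cos θ * K₂.eval u θ - Real.sin θ * K₁.eval u θ := by
      simp [angularPart]
    rw [hF u θ, hfw, hwθ, hG, hH]
    have hcs := Real.sin_sq_add_cos_sq (θ : ℝ)
    ext
    · simp only
      linear_combination (-(u θ ^ 2 * K₁.eval u θ)) * hcs
    · simp only
      linear_combination (-(u θ ^ 2 * K₂.eval u θ)) * hcs
  · simp [hs0, hr0]
  · have := hru fullTurn
    simp only [fullTurn] at this
    simp [hsT, this, fullTurn]
  · rintro t ⟨ht0, htT⟩ ⟨h1, h2⟩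
    have hlo : 0 < e.symm t := by rw [← hs0]; exact e.symm.strictMono ht0
    have hhi : e.symm t < 2 * Real.pi := by rw [← hsT]; exact e.symm.strictMono htT
    have hp := hpos ⟨e.symm t, hlo.le, hhi.le⟩
    rw [← hru] at hp
    simp only at h1 h2 hp
    have hrne : r (e.symm t) ≠ 0 := right_ne_zero_of_mul hp.ne'
    -- Strictly inside the turn the `x`-axis is met only at angle `π`, which lies on the opposite
    -- half-axis.
    obtain ⟨n, hn⟩ := Real.sin_eq_zero_iff.1 ((mul_eq_zero.1 h2).resolve_left hrne)
    have hn0 : 0 < n := by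
      have : (0 : ℝ) < n := by
        by_contra h
        nlinarith [Real.pi_pos]
      exact_mod_cast this
    have hn2 : n < 2 := by
      have : (n : ℝ) < 2 := by
        by_contra h
        nlinarith [Real.pi_pos]
      exact_mod_cast this
    obtain rfl : n = 1 := by omega
    rw [← hn, Int.cast_one, one_mul] at h1 hp
    rw [Real.cos_pi] at h1
    linarith

/-- The integral curves of a `C¹` field are unique, hence so is the first return point. -/
lemma IsFirstReturn.unique {F : ℝ × ℝ → ℝ × ℝ} (hF : ContDiff ℝ 1 F) {s p q : ℝ}
    (hp : IsFirstReturn F s p) (hq : IsFirstReturn F s q) : p = q := by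
  obtain ⟨T, γ, hT, hγ, hγ0, hγT, hsp, hγn⟩ := hp
  obtain ⟨S, δ, hS, hδ, hδ0, hδS, hsq, hδn⟩ := hq
  have key : Set.EqOn γ δ (Set.Icc 0 (min T S)) := by
    have hγc : ContinuousOn γ (Set.Icc 0 (min T S)) := fun t ht =>
      ((hγ t ⟨ht.1, ht.2.trans (min_le_left _ _)⟩).continuousWithinAt).mono
        (Set.Icc_subset_Icc le_rfl (min_le_left _ _))
    have hδc : ContinuousOn δ (Set.Icc 0 (min T S)) := fun t ht =>
      ((hδ t ⟨ht.1, ht.2.trans (min_le_right _ _)⟩).continuousWithinAt).mono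
        (Set.Icc_subset_Icc le_rfl (min_le_right _ _))
    -- Both arcs lie in one closed ball, where the `C¹` field is Lipschitz.
    obtain ⟨R, hR⟩ := ((isCompact_Icc.image_of_continuousOn hγc).union
      (isCompact_Icc.image_of_continuousOn hδc)).isBounded.subset_closedBall 0
    obtain ⟨K, hK⟩ := hF.contDiffOn.exists_lipschitzOnWith one_ne_zero
      (convex_closedBall (0 : ℝ × ℝ) R) (isCompact_closedBall _ _)
    have right : ∀ {x : ℝ → ℝ × ℝ} {b t : ℝ}, t < b → 0 ≤ t →
        HasDerivWithinAt x (F (x t)) (Set.Icc 0 b) t →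
        HasDerivWithinAt x (F (x t)) (Set.Ici t) t := fun htb h0 h =>
      (h.mono (Set.Icc_subset_Icc h0 le_rfl)).mono_of_mem_nhdsWithin
        (Icc_mem_nhdsGE htb)
    refine ODE_solution_unique_of_mem_Icc_right (v := fun _ => F)
      (s := fun _ => Metric.closedBall 0 R) (K := K) (fun _ _ => hK) hγc (fun t ht => ?_)
      (fun t ht => hR (Or.inl ⟨t, Set.Ico_subset_Icc_self ht, rfl⟩)) hδc (fun t ht => ?_)
      (fun t ht => hR (Or.inr ⟨t, Set.Ico_subset_Icc_self ht, rfl⟩)) (hγ0.trans hδ0.symm)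
    · have := ht.2.trans_le (min_le_left _ _)
      exact right this ht.1 (hγ t ⟨ht.1, this.le⟩)
    · have := ht.2.trans_le (min_le_right _ _)
      exact right this ht.1 (hδ t ⟨ht.1, this.le⟩)
  -- The curves coincide up to the earlier return time, so unequal times would give the later one a
  -- premature return.
  rcases lt_trichotomy T S with h | h | h
  · exfalso
    refine hδn T ⟨hT, h⟩ ?_
    rw [← key ⟨hT.le, le_min le_rfl h.le⟩, hγT]
    exact ⟨hsp, rfl⟩
  · subst h
    have := key ⟨hT.le, le_min le_rfl le_rfl⟩
    rw [hγT, hδS] at this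
    exact congrArg Prod.fst this
  · exfalso
    refine hγn S ⟨hS, h⟩ ?_
    rw [key ⟨hS.le, le_min h.le le_rfl⟩, hδS]
    exact ⟨hsq, rfl⟩

end FirstReturn

/-! ### Smoothness, expansion and derivatives of the return map. -/

section ReturnMap

open Asymptotics Polynomial

/-- A field in polar form has a `C³` return map near the origin with a known expansion. -/
lemma exists_return_map {F : ℝ × ℝ → ℝ × ℝ} {K₁ K₂ : AngleFun[X]} (hF : HasPolarForm F K₁ K₂)
    {g₀ g₁ h₀ : AngleFun} (hg₀ : (radialPart K₁ K₂).coeff 0 = g₀)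
    (hg₁ : (radialPart K₁ K₂).coeff 1 = g₁) (hh₀ : (angularPart K₁ K₂).coeff 0 = h₀) :
    ∃ P : ℝ → ℝ, ContDiffAt ℝ 3 P 0 ∧ P 0 = 0 ∧
      (∀ᶠ s in 𝓝[≠] (0 : ℝ), IsFirstReturn F s (P s)) ∧
      (fun s => P s - (s + s ^ 2 * AngleFun.integralCLM g₀ fullTurn
        + s ^ 3 * AngleFun.integralCLM
          (2 * g₀ * AngleFun.integralCLM g₀ + (g₁ - g₀ * h₀)) fullTurn))
        =O[𝓝 0] fun s => s ^ 4 := by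
  obtain ⟨u, hu, hu0, hfix⟩ := exists_smooth_radial_solution (radialPart K₁ K₂)
    (angularPart K₁ K₂) AngleFun.integralCLM (n := 3) (by norm_num)
  have hdiff : DifferentiableAt ℝ u 0 := hu.differentiableAt (by norm_num)
  have ut : Tendsto u (𝓝 0) (𝓝 0) := by simpa [hu0] using hdiff.continuousAt.tendsto
  refine ⟨fun s => u s fullTurn, ?_, by simp [hu0], ?_, ?_⟩
  · exact (ContinuousMap.evalCLM ℝ fullTurn).contDiff.contDiffAt.comp (0 : ℝ) hu
  -- This keeps `u s θ` on the same side of 0 as `s` for every angle.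
  · have small : ∀ᶠ s in 𝓝 (0 : ℝ), ‖u s - s • (1 : AngleFun)‖ ≤ 1 / 2 * ‖s‖ := by
      have h1 : (fun v => radialField (radialPart K₁ K₂) (angularPart K₁ K₂) v)
          =o[𝓝 0] fun v : AngleFun => v := by
        simpa [radialField] using
          (hasFDerivAt_radialField (radialPart K₁ K₂) (angularPart K₁ K₂)).isLittleO
      have h2 : u =O[𝓝 0] fun s : ℝ => s := by
        simpa [hu0] using hdiff.hasFDerivAt.isBigO_sub
      have h3 := (AngleFun.integralCLM.isBigO_comp
        (fun s => radialField (radialPart K₁ K₂) (angularPart K₁ K₂) (u s)) (𝓝 (0 : ℝ))).trans_isLittleO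
        ((h1.comp_tendsto ut).trans_isBigO h2)
      filter_upwards [h3.def (by norm_num : (0 : ℝ) < 1 / 2), hfix] with s h hs
      rw [sub_eq_of_eq_add' hs]
      exact h
    -- This keeps the angular speed positive.
    have ang : ∀ᶠ s in 𝓝 (0 : ℝ), ‖u s * (angularPart K₁ K₂).eval (u s)‖ < 1 := by
      have hc : Continuous fun v : AngleFun => ‖v * (angularPart K₁ K₂).eval v‖ :=
        (continuous_id.mul (contDiff_polynomial_eval (n := 0) _).continuous).norm
      have := (hc.tendsto 0).comp ut
      rw [zero_mul, norm_zero] at this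
      exact this.eventually (gt_mem_nhds one_pos)
    filter_upwards [nhdsWithin_le_nhds small, nhdsWithin_le_nhds ang,
      nhdsWithin_le_nhds hfix, self_mem_nhdsWithin] with s h1 h2 h3 hs
    have hs' : s ≠ 0 := hs
    refine isFirstReturn_of_radial_solution hF h3 (fun θ => ?_) (fun θ => ?_)
    · have h : |u s θ - s| ≤ 1 / 2 * |s| := by
        have := ((u s - s • (1 : AngleFun)).norm_coe_le_norm θ).trans h1
        simpa using this
      rcases lt_or_gt_of_ne hs' with hneg | hpos
      · rw [abs_of_neg hneg, abs_le] at h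
        exact mul_pos_of_neg_of_neg hneg (by linarith)
      · rw [abs_of_pos hpos, abs_le] at h
        exact mul_pos hpos (by linarith)
    · have h : |u s θ * (angularPart K₁ K₂).eval (u s) θ| < 1 :=
        ((u s * (angularPart K₁ K₂).eval (u s)).norm_coe_le_norm θ).trans_lt h2
      linarith [(abs_lt.1 h).1]
  · have := radial_solution_expansion (radialPart K₁ K₂) (angularPart K₁ K₂)
      AngleFun.integralCLM hdiff hu0 hfix
    rw [hg₀, hg₁, hh₀] at this
    refine (((ContinuousMap.evalCLM ℝ fullTurn).isBigO_comp _ _).trans this).congr_left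
      fun s => ?_
    simp [mul_add]

/-- Uniqueness of the return point makes the choice in the definition immaterial. -/
lemma poincareMap_eq {F : ℝ × ℝ → ℝ × ℝ} (hF : ContDiff ℝ 1 F) {s p : ℝ}
    (h : IsFirstReturn F s p) : poincareMap F s = p := by
  have hex : ∃ p, IsFirstReturn F s p := ⟨p, h⟩
  rw [poincareMap, dif_pos hex]
  exact hex.choose_spec.unique hF h

lemma poincareMap_zero (F : ℝ × ℝ → ℝ × ℝ) : poincareMap F 0 = 0 := by
  rw [poincareMap, dif_neg]
  rintro ⟨p, T, γ, -, -, -, -, h, -⟩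
  simp at h

/-- A polynomial of degree at most `n` that is `o(xⁿ)` at `0` vanishes. -/
lemma polynomial_eq_zero_of_isLittleO (n : ℕ) (p : ℝ[X]) (hd : p.natDegree ≤ n)
    (h : (fun x => p.eval x) =o[𝓝[≠] (0 : ℝ)] fun x => x ^ n) : p = 0 := by
  induction n generalizing p with
  | zero =>
    rw [eq_C_of_natDegree_le_zero hd] at h ⊢
    simp only [eval_C, pow_zero, isLittleO_one_iff] at h
    rw [tendsto_nhds_unique tendsto_const_nhds h, C_0]
  | succ n ih =>
    have hp0 : p.coeff 0 = 0 := by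
      have h1 : Tendsto (fun x => p.eval x) (𝓝[≠] (0 : ℝ)) (𝓝 (p.eval 0)) :=
        (p.continuous.tendsto 0).mono_left nhdsWithin_le_nhds
      have h2 : Tendsto (fun x => p.eval x) (𝓝[≠] (0 : ℝ)) (𝓝 0) := by
        refine h.isBigO.trans_tendsto ?_
        have : Tendsto (fun x : ℝ => x ^ (n + 1)) (𝓝 0) (𝓝 (0 ^ (n + 1))) :=
          (continuous_pow (n + 1)).tendsto 0
        rw [zero_pow n.succ_ne_zero] at this
        exact this.mono_left nhdsWithin_le_nhds
      rw [coeff_zero_eq_eval_zero]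
      exact tendsto_nhds_unique h1 h2
    have hp : X * p.divX = p := by
      simpa [hp0] using p.X_mul_divX_add
    have hq : p.divX = 0 := by
      refine ih _ ?_ ?_
      · rw [natDegree_divX_eq_natDegree_tsub_one]; omega
      · have h3 := (isBigO_refl (fun x : ℝ => x⁻¹) (𝓝[≠] (0 : ℝ))).mul_isLittleO h
        refine h3.congr' ?_ ?_
        · filter_upwards [self_mem_nhdsWithin] with x hx
          have hx' : x ≠ 0 := hx
          nth_rw 1 [← hp]
          rw [eval_mul, eval_X]
          field_simp
        · filter_upwards [self_mem_nhdsWithin] with x hx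
          have hx' : x ≠ 0 := hx
          rw [pow_succ]
          field_simp
    rw [← hp, hq, mul_zero]

/-- The derivatives up to order `n` of a `Cⁿ` function that agrees with a polynomial of degree at
most `n` up to `o(xⁿ)`. -/
lemma iteratedDeriv_eq_of_isLittleO {f : ℝ → ℝ} {n : ℕ} (hf : ContDiffAt ℝ n f 0) {p : ℝ[X]}
    (hd : p.natDegree ≤ n) (h : (fun x => f x - p.eval x) =o[𝓝 (0 : ℝ)] fun x => x ^ n)
    {k : ℕ} (hk : k ≤ n) : iteratedDeriv k f 0 = k.factorial * p.coeff k := by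
  obtain ⟨v, hv, hfv⟩ := hf.contDiffOn le_rfl (by simp)
  obtain ⟨ε, hε, hball⟩ := Metric.mem_nhds_iff.1 hv
  have hfb : ContDiffOn ℝ n f (Metric.ball 0 ε) := hfv.mono hball
  have h0 : (0 : ℝ) ∈ Metric.ball (0 : ℝ) ε := Metric.mem_ball_self hε
  have ht := taylor_isLittleO (convex_ball (0 : ℝ) ε) h0 hfb
  rw [Metric.isOpen_ball.nhdsWithin_eq h0] at ht
  set q : ℝ[X] := ∑ i ∈ Finset.range (n + 1),
    C ((i.factorial : ℝ)⁻¹ * iteratedDerivWithin i f (Metric.ball 0 ε) 0) * X ^ i with hq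
  have hqe : ∀ x, taylorWithinEval f n (Metric.ball 0 ε) 0 x = q.eval x := by
    intro x
    rw [taylor_within_apply, hq, eval_finsetSum]
    refine Finset.sum_congr rfl fun i _ => ?_
    simp only [sub_zero, smul_eq_mul, eval_mul, eval_C, eval_pow, eval_X]
    ring
  have hqd : q.natDegree ≤ n :=
    natDegree_sum_le_of_forall_le _ _ fun i hi =>
      (natDegree_C_mul_X_pow_le _ _).trans (by simpa [Nat.lt_succ_iff] using hi)
  -- `q` is the Taylor polynomial of `f`; both polynomials approximate `f` to `o(xⁿ)`.
  have hpq : p - q = 0 := by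
    refine polynomial_eq_zero_of_isLittleO n _ (natDegree_sub_le_of_le hd hqd |>.trans (by simp)) ?_
    refine IsLittleO.mono ?_ nhdsWithin_le_nhds
    simp only [sub_zero] at ht
    refine (ht.sub h).congr_left fun x => ?_
    rw [hqe, eval_sub]; ring
  have hc : q.coeff k
      = (k.factorial : ℝ)⁻¹ * iteratedDerivWithin k f (Metric.ball 0 ε) 0 := by
    rw [hq, finsetSum_coeff, Finset.sum_eq_single k]
    · rw [coeff_C_mul_X_pow, if_pos rfl]
    · intro b _ hb
      rw [coeff_C_mul_X_pow, if_neg hb.symm]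
    · intro hk'
      simp [hk] at hk'
  rw [sub_eq_zero.1 hpq, hc, iteratedDerivWithin_of_isOpen Metric.isOpen_ball h0]
  field_simp

end ReturnMap

/-! ### Trigonometric integrals over a full turn. -/

section Trigonometry

namespace AngleFun

lemma primitive_eq_sub {f : AngleFun} {Φ : ℝ → ℝ}
    (h : ∀ θ : Set.Icc (0 : ℝ) (2 * Real.pi), HasDerivAt Φ (f θ) θ)
    (θ : Set.Icc (0 : ℝ) (2 * Real.pi)) : f.primitive θ = Φ θ - Φ 0 := by
  refine intervalIntegral.integral_eq_sub_of_hasDerivAt (fun x hx => ?_)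
    (f.continuous_extend.intervalIntegrable _ _)
  rw [Set.uIcc_of_le θ.2.1] at hx
  have hx' : x ∈ Set.Icc (0 : ℝ) (2 * Real.pi) := ⟨hx.1, hx.2.trans θ.2.2⟩
  rw [f.extend_of_mem hx']
  exact h ⟨x, hx'⟩

/-- The integrand is the derivative of the squared primitive. Hence this part of the `s³`
coefficient disappears once the `s²` coefficient does. -/
lemma integralCLM_two_mul_self (g : AngleFun) (θ : Set.Icc (0 : ℝ) (2 * Real.pi)) :
    integralCLM (2 * g * integralCLM g) θ = (integralCLM g θ) ^ 2 := by
  rw [integralCLM_apply, primitive_eq_sub (Φ := fun x => g.primitive x ^ 2), primitive_zero]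
  · simp [integralCLM_apply]
  · intro x
    have := (g.hasDerivAt_primitive x).pow 2
    rw [g.extend_coe] at this
    convert! this using 1
    have h2 : (2 : AngleFun) x = 2 := rfl
    simp [integralCLM_apply, h2]
    ring

/-- The trigonometric cubics that occur have mean zero. -/
lemma integral_cubic (a b c : ℝ) :
    integralCLM (a • (cos ^ 2 * sin) + b • (cos * sin ^ 2) + c • sin ^ 3) fullTurn = 0 := by
  rw [integralCLM_apply, primitive_eq_sub (Φ := fun x => -a * Real.cos x ^ 3 / 3
    + b * Real.sin x ^ 3 / 3 + c * (Real.cos x ^ 3 / 3 - Real.cos x))]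
  · simp [fullTurn]
  · intro x
    have hs := Real.hasDerivAt_sin x
    have hc := Real.hasDerivAt_cos x
    have := ((((hc.pow 3).const_mul (-a)).div_const 3).add
      (((hs.pow 3).const_mul b).div_const 3)).add
      ((((hc.pow 3).div_const 3).sub hc).const_mul c)
    convert! this using 1
    simp
    linear_combination (c * Real.sin x) * Real.sin_sq_add_cos_sq (x : ℝ)

/-- Only monomials even in both `cos` and `sin` survive; the non-periodic terms `x / 8` and `3 * x /
8` of the antiderivative carry their means. -/
lemma integral_quartic (a b c d : ℝ) :
    integralCLM (a • (cos ^ 3 * sin) + b • (cos ^ 2 * sin ^ 2) + c • (cos * sin ^ 3) + d • sin ^ 4)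
      fullTurn = Real.pi / 4 * (b + 3 * d) := by
  rw [integralCLM_apply, primitive_eq_sub (Φ := fun x => a * (-(Real.cos x ^ 4) / 4)
    + b * (x / 8 + Real.cos x * (2 * Real.sin x ^ 3 - Real.sin x) / 8) + c * (Real.sin x ^ 4 / 4)
    + d * (3 * x / 8 - Real.cos x * (2 * Real.sin x ^ 3 + 3 * Real.sin x) / 8))]
  · simp [fullTurn]
    ring
  · intro x
    have hx := hasDerivAt_id (x : ℝ)
    have hs := Real.hasDerivAt_sin x
    have hc := Real.hasDerivAt_cos x
    have := (((((hc.pow 4).neg.div_const 4).const_mul a).add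
      (((hx.div_const 8).add ((hc.mul (((hs.pow 3).const_mul 2).sub hs)).div_const 8)).const_mul b)).add
      (((hs.pow 4).div_const 4).const_mul c)).add
      ((((hx.const_mul 3).div_const 8).sub
        ((hc.mul (((hs.pow 3).const_mul 2).add (hs.const_mul 3))).div_const 8)).const_mul d)
    convert! this using 1
    have h1 := Real.sin_sq_add_cos_sq (x : ℝ)
    simp
    grind

/-- Again only the even monomials survive, through the terms `x / 16`, `x / 16` and `5 * x / 16`. -/
lemma integral_sextic (a b c d e : ℝ) :
    integralCLM (a • (cos ^ 4 * sin ^ 2) + b • (cos ^ 3 * sin ^ 3) + c • (cos ^ 2 * sin ^ 4)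
      + d • (cos * sin ^ 5) + e • sin ^ 6) fullTurn = Real.pi / 8 * (a + c + 5 * e) := by
  rw [integralCLM_apply, primitive_eq_sub (Φ := fun x =>
    a * (x / 16 + Real.cos x * (-8 * Real.sin x ^ 5 + 14 * Real.sin x ^ 3 - 3 * Real.sin x) / 48)
    + b * (Real.sin x ^ 4 / 4 - Real.sin x ^ 6 / 6)
    + c * (x / 16 + Real.cos x * (8 * Real.sin x ^ 5 - 2 * Real.sin x ^ 3 - 3 * Real.sin x) / 48)
    + d * (Real.sin x ^ 6 / 6)
    + e * (5 * x / 16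
      - Real.cos x * (8 * Real.sin x ^ 5 + 10 * Real.sin x ^ 3 + 15 * Real.sin x) / 48))]
  · simp [fullTurn]
    ring
  · intro x
    have hx := hasDerivAt_id (x : ℝ)
    have hs := Real.hasDerivAt_sin x
    have hc := Real.hasDerivAt_cos x
    have := ((((((hx.div_const 16).add ((hc.mul ((((hs.pow 5).const_mul (-8)).add
      ((hs.pow 3).const_mul 14)).sub (hs.const_mul 3))).div_const 48)).const_mul a).add
      ((((hs.pow 4).div_const 4).sub ((hs.pow 6).div_const 6)).const_mul b)).add
      (((hx.div_const 16).add ((hc.mul ((((hs.pow 5).const_mul 8).sub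
      ((hs.pow 3).const_mul 2)).sub (hs.const_mul 3))).div_const 48)).const_mul c)).add
      (((hs.pow 6).div_const 6).const_mul d)).add
      ((((hx.const_mul 5).div_const 16).sub ((hc.mul ((((hs.pow 5).const_mul 8).add
      ((hs.pow 3).const_mul 10)).add (hs.const_mul 15))).div_const 48)).const_mul e)
    convert! this using 1
    have h1 := Real.sin_sq_add_cos_sq (x : ℝ)
    simp
    grind

end AngleFun

end Trigonometry

/-! ### The boundary polynomial near the origin. -/

section GraphNonlinearity

open Polynomial

variable {V : Type*} [Fintype V] (G : SimpleGraph V)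

lemma graphBoundary_empty : graphBoundary G ∅ = ∅ := by
  simp [graphBoundary]

variable {G}

/-- Without isolated vertices, a nonempty set together with its boundary has two vertices. -/
lemma two_le_card_boundary_add_card (hiso : ∀ v, ¬ G.IsIsolated v) {S : Finset V}
    (hS : S.Nonempty) : 2 ≤ (graphBoundary G S).card + S.card := by
  have h1 : 1 ≤ S.card := hS.card_pos
  rcases h1.eq_or_lt with h | h
  · obtain ⟨v, rfl⟩ := Finset.card_eq_one.1 h.symm
    obtain ⟨w, hw⟩ : ∃ w, G.Adj v w := by
      simpa [SimpleGraph.IsIsolated] using hiso v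
    have : w ∈ graphBoundary G {v} := by
      simp [graphBoundary, hw, hw.ne']
    have := Finset.card_pos.2 ⟨w, this⟩
    omega
  · omega

variable (G) in
/-- The vertex sets that contribute to the nonlinear terms. -/
noncomputable def nonlinearSets : Finset (Finset V) :=
  {S : Finset V | 2 ≤ (graphBoundary G S).card + S.card}

lemma mem_nonlinearSets {S : Finset V} :
    S ∈ nonlinearSets G ↔ 2 ≤ (graphBoundary G S).card + S.card := by
  simp [nonlinearSets]

lemma nonempty_of_mem_nonlinearSets {S : Finset V} (h : S ∈ nonlinearSets G) : S.Nonempty := by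
  rw [mem_nonlinearSets] at h
  by_contra hS
  rw [Finset.not_nonempty_iff_eq_empty] at hS
  subst hS
  simp [graphBoundary_empty] at h

lemma boundaryPoly_eq (hiso : ∀ v, ¬ G.IsIsolated v) (x y : ℝ) :
    boundaryPoly G x y
      = 1 + ∑ S ∈ nonlinearSets G, x ^ (graphBoundary G S).card * y ^ S.card := by
  classical
  have h : (Finset.univ : Finset (Finset V)) = insert ∅ (nonlinearSets G) := by
    ext S
    simp only [Finset.mem_univ, Finset.mem_insert, true_iff]
    rcases S.eq_empty_or_nonempty with hS | hS
    · exact Or.inl hS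
    · exact Or.inr (mem_nonlinearSets.2 (two_le_card_boundary_add_card hiso hS))
  rw [boundaryPoly, h, Finset.sum_insert]
  · simp [graphBoundary_empty]
  · intro hm
    simpa using nonempty_of_mem_nonlinearSets hm

variable (G) in
/-- The nonlinear part of the boundary polynomial at `(r cos θ, r sin θ)`, divided by `r²`, as a
polynomial in `r`. -/
noncomputable def polarBoundary : AngleFun[X] :=
  -- The truncated subtraction is exact on `nonlinearSets G`.
  ∑ S ∈ nonlinearSets G, monomial ((graphBoundary G S).card + S.card - 2)
    (AngleFun.cos ^ (graphBoundary G S).card * AngleFun.sin ^ S.card)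

lemma boundaryPoly_polar (hiso : ∀ v, ¬ G.IsIsolated v) (u : AngleFun)
    (θ : Set.Icc (0 : ℝ) (2 * Real.pi)) :
    boundaryPoly G (u θ * Real.cos θ) (u θ * Real.sin θ)
      = 1 + u θ ^ 2 * (polarBoundary G).eval u θ := by
  rw [boundaryPoly_eq hiso, polarBoundary, eval_finsetSum, ContinuousMap.sum_apply,
    Finset.mul_sum]
  congr 1
  refine Finset.sum_congr rfl fun S hS => ?_
  obtain ⟨m, hm⟩ := Nat.exists_eq_add_of_le (mem_nonlinearSets.1 hS)
  have hu : u θ ^ (graphBoundary G S).card * u θ ^ S.card = u θ ^ 2 * u θ ^ m := by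
    rw [← pow_add, ← pow_add, hm]
  simp only [eval_monomial, ContinuousMap.mul_apply, ContinuousMap.pow_apply, AngleFun.cos_apply,
    AngleFun.sin_apply, mul_pow, hm, add_tsub_cancel_left]
  linear_combination
    (Real.cos θ ^ (graphBoundary G S).card * Real.sin θ ^ S.card) * hu

lemma polarBoundary_coeff (n : ℕ) : (polarBoundary G).coeff n
    = ∑ p ∈ Finset.HasAntidiagonal.antidiagonal (n + 2),
        boundaryCoeff G p.1 p.2 • (AngleFun.cos ^ p.1 * AngleFun.sin ^ p.2) := by
  classical
  have h1 : (polarBoundary G).coeff n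
      = ∑ S : Finset V with (graphBoundary G S).card + S.card = n + 2,
          AngleFun.cos ^ (graphBoundary G S).card * AngleFun.sin ^ S.card := by
    rw [polarBoundary, finsetSum_coeff]
    simp only [coeff_monomial]
    rw [← Finset.sum_filter]
    refine Finset.sum_congr ?_ fun _ _ => rfl
    ext S
    simp only [Finset.mem_filter, mem_nonlinearSets, Finset.mem_univ, true_and]
    omega
  rw [h1, ← Finset.sum_fiberwise_of_maps_to' (t := Finset.HasAntidiagonal.antidiagonal (n + 2))
    (g := fun S : Finset V => ((graphBoundary G S).card, S.card))
    (f := fun p : ℕ × ℕ => AngleFun.cos ^ p.1 * AngleFun.sin ^ p.2)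
    (fun S hS => by simpa using hS)]
  refine Finset.sum_congr rfl fun p hp => ?_
  rw [Finset.sum_const, boundaryCoeff]
  congr 2
  ext S
  rw [Finset.HasAntidiagonal.mem_antidiagonal] at hp
  simp only [Finset.mem_filter, Finset.mem_univ, true_and, Prod.ext_iff]
  omega

/-- Only the empty set has size 0, and its boundary is empty; so pure powers of `x` never occur in
the nonlinearity. -/
lemma boundaryCoeff_succ_zero (i : ℕ) : boundaryCoeff G (i + 1) 0 = 0 := by
  classical
  rw [boundaryCoeff, Finset.card_eq_zero, Finset.filter_eq_empty_iff]
  rintro S - ⟨h1, h2⟩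
  rw [Finset.card_eq_zero] at h2
  subst h2
  simp [graphBoundary_empty] at h1

lemma polarBoundary_coeff_zero : (polarBoundary G).coeff 0
    = (boundaryCoeff G 1 1 : ℝ) • (AngleFun.cos * AngleFun.sin)
      + (boundaryCoeff G 0 2 : ℝ) • AngleFun.sin ^ 2 := by
  rw [polarBoundary_coeff, Finset.Nat.sum_antidiagonal_eq_sum_range_succ_mk]
  simp [Finset.sum_range_succ, boundaryCoeff_succ_zero 1, Nat.cast_smul_eq_nsmul]
  abel

lemma polarBoundary_coeff_one : (polarBoundary G).coeff 1
    = (boundaryCoeff G 2 1 : ℝ) • (AngleFun.cos ^ 2 * AngleFun.sin)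
      + (boundaryCoeff G 1 2 : ℝ) • (AngleFun.cos * AngleFun.sin ^ 2)
      + (boundaryCoeff G 0 3 : ℝ) • AngleFun.sin ^ 3 := by
  rw [polarBoundary_coeff, Finset.Nat.sum_antidiagonal_eq_sum_range_succ_mk]
  simp [Finset.sum_range_succ, boundaryCoeff_succ_zero 2, Nat.cast_smul_eq_nsmul]
  abel

lemma contDiff_boundaryPoly {n : WithTop ℕ∞} :
    ContDiff ℝ n fun z : ℝ × ℝ => boundaryPoly G z.1 z.2 := by
  unfold boundaryPoly
  fun_prop

lemma boundaryPoly_zero (hiso : ∀ v, ¬ G.IsIsolated v) : boundaryPoly G 0 0 = 1 := by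
  rw [boundaryPoly_eq hiso, Finset.sum_eq_zero, add_zero]
  intro S hS
  rw [zero_pow (nonempty_of_mem_nonlinearSets hS).card_pos.ne', mul_zero]

lemma hasFDerivAt_boundaryPoly (hiso : ∀ v, ¬ G.IsIsolated v) :
    HasFDerivAt (fun z : ℝ × ℝ => boundaryPoly G z.1 z.2) (0 : ℝ × ℝ →L[ℝ] ℝ) 0 := by
  simp only [boundaryPoly_eq hiso]
  refine HasFDerivAt.const_add 1 ?_
  rw [← Finset.sum_const_zero (s := nonlinearSets G)]
  refine HasFDerivAt.fun_sum fun S hS => ?_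
  have h2 := mem_nonlinearSets.1 hS
  have h1 := (nonempty_of_mem_nonlinearSets hS).card_pos
  generalize (graphBoundary G S).card = i at h2 ⊢
  generalize S.card = j at h1 h2 ⊢
  have := ((hasFDerivAt_fst (𝕜 := ℝ) (p := (0 : ℝ × ℝ))).pow i).mul
    ((hasFDerivAt_snd (𝕜 := ℝ) (p := (0 : ℝ × ℝ))).pow j)
  convert! this using 1
  -- For `i = 0` the exponent of `y` is at least 2; otherwise both powers vanish at the origin,
  -- since `j ≥ 1`.
  rcases i with _ | i
  · have : j - 1 ≠ 0 := by omega
    simp [this]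
  · simp [h1.ne']

end GraphNonlinearity

/-! ### The planar system of a pair of graphs. -/

section GraphSystem

variable {V₁ V₂ : Type*} [Fintype V₁] [Fintype V₂] {G₁ : SimpleGraph V₁} {G₂ : SimpleGraph V₂}

lemma contDiff_graphField (α : ℝ) {n : WithTop ℕ∞} : ContDiff ℝ n (graphField G₁ G₂ α) := by
  have h1 : ContDiff ℝ n fun z : ℝ × ℝ => boundaryPoly G₁ z.1 z.2 := contDiff_boundaryPoly
  have h2 : ContDiff ℝ n fun z : ℝ × ℝ => boundaryPoly G₂ z.1 z.2 := contDiff_boundaryPoly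
  unfold graphField
  fun_prop

lemma hasPolarForm_graphField (hiso₁ : ∀ v, ¬ G₁.IsIsolated v) (hiso₂ : ∀ v, ¬ G₂.IsIsolated v) :
    HasPolarForm (graphField G₁ G₂ 0) (polarBoundary G₁) (polarBoundary G₂) := by
  intro u θ
  simp only [graphField, boundaryPoly_polar hiso₁, boundaryPoly_polar hiso₂]
  ext <;> simp only <;> ring

/-- The boundary polynomials have zero derivative at the origin, which leaves the quarter turn `(x,
y) ↦ (-y, x)`. -/
lemma isLinearCenter_graphField (hiso₁ : ∀ v, ¬ G₁.IsIsolated v)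
    (hiso₂ : ∀ v, ¬ G₂.IsIsolated v) : IsLinearCenter (graphField G₁ G₂ 0) := by
  have hd : HasFDerivAt (graphField G₁ G₂ 0)
      ((-ContinuousLinearMap.snd ℝ ℝ ℝ).prod (ContinuousLinearMap.fst ℝ ℝ ℝ)) 0 := by
    have h1 := ((hasFDerivAt_snd (𝕜 := ℝ) (p := (0 : ℝ × ℝ))).neg.add
      (hasFDerivAt_boundaryPoly hiso₁)).sub_const 1
    have h2 := ((hasFDerivAt_fst (𝕜 := ℝ) (p := (0 : ℝ × ℝ))).add
      (hasFDerivAt_boundaryPoly hiso₂)).sub_const 1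
    convert! h1.prodMk h2 using 1
    · ext z <;> simp [graphField]
    · simp
  set L : ℝ × ℝ →L[ℝ] ℝ × ℝ :=
    (-ContinuousLinearMap.snd ℝ ℝ ℝ).prod (ContinuousLinearMap.fst ℝ ℝ ℝ) with hL
  have hM : LinearMap.toMatrix (Module.Basis.finTwoProd ℝ) (Module.Basis.finTwoProd ℝ)
      (L : ℝ × ℝ →ₗ[ℝ] ℝ × ℝ)
      = !![0, -1; 1, 0] := by
    ext i j
    fin_cases i <;> fin_cases j <;> simp [LinearMap.toMatrix_apply, hL]
  refine ⟨?_, hd.differentiableAt, ?_, ?_⟩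
  · simp [graphField, boundaryPoly_zero hiso₁, boundaryPoly_zero hiso₂]
  · rw [hd.fderiv, LinearMap.trace_eq_matrix_trace ℝ (Module.Basis.finTwoProd ℝ), hM]
    simp [Matrix.trace_fin_two]
  · rw [hd.fderiv, ← LinearMap.det_toMatrix (Module.Basis.finTwoProd ℝ), hM]
    simp [Matrix.det_fin_two]

/-- The coefficients of `s²` and `s³` in the return map. -/
lemma integral_radial_coefficients (a₁₁ a₀₂ a₂₁ a₁₂ a₀₃ b₁₁ b₀₂ b₂₁ b₁₂ b₀₃ : ℝ)
    {k₁ k₂ l₁ l₂ : AngleFun}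
    (hk₁ : k₁ = a₁₁ • (AngleFun.cos * AngleFun.sin) + a₀₂ • AngleFun.sin ^ 2)
    (hk₂ : k₂ = b₁₁ • (AngleFun.cos * AngleFun.sin) + b₀₂ • AngleFun.sin ^ 2)
    (hl₁ : l₁ = a₂₁ • (AngleFun.cos ^ 2 * AngleFun.sin)
      + a₁₂ • (AngleFun.cos * AngleFun.sin ^ 2) + a₀₃ • AngleFun.sin ^ 3)
    (hl₂ : l₂ = b₂₁ • (AngleFun.cos ^ 2 * AngleFun.sin)
      + b₁₂ • (AngleFun.cos * AngleFun.sin ^ 2) + b₀₃ • AngleFun.sin ^ 3) :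
    AngleFun.integralCLM (AngleFun.cos * k₁ + AngleFun.sin * k₂) fullTurn = 0 ∧
    AngleFun.integralCLM ((AngleFun.cos * l₁ + AngleFun.sin * l₂)
      - (AngleFun.cos * k₁ + AngleFun.sin * k₂) * (AngleFun.cos * k₂ - AngleFun.sin * k₁)) fullTurn
      = Real.pi / 4 * (3 * b₀₃ + a₁₂ + b₂₁ + 2 * a₀₂ * b₀₂ + a₁₁ * a₀₂ - b₁₁ * b₀₂) := by
  constructor
  · refine Eq.trans ?_ (AngleFun.integral_cubic a₁₁ (a₀₂ + b₁₁) b₀₂)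
    rw [hk₁, hk₂]
    congr 2
    simp only [Algebra.smul_def, map_add]
    ring
  · have e : (AngleFun.cos * l₁ + AngleFun.sin * l₂)
        - (AngleFun.cos * k₁ + AngleFun.sin * k₂) * (AngleFun.cos * k₂ - AngleFun.sin * k₁)
        -- Cubic terms of the field give the quartic form, products of quadratic terms the sextic
        -- one. On integration the `a₁₁ * b₁₁` contributions cancel.
        = (a₂₁ • (AngleFun.cos ^ 3 * AngleFun.sin)
            + (a₁₂ + b₂₁) • (AngleFun.cos ^ 2 * AngleFun.sin ^ 2)
            + (a₀₃ + b₁₂) • (AngleFun.cos * AngleFun.sin ^ 3) + b₀₃ • AngleFun.sin ^ 4)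
          - ((a₁₁ * b₁₁) • (AngleFun.cos ^ 4 * AngleFun.sin ^ 2)
            + (a₁₁ * (b₀₂ - a₁₁) + (a₀₂ + b₁₁) * b₁₁) • (AngleFun.cos ^ 3 * AngleFun.sin ^ 3)
            + (-(a₁₁ * a₀₂) + (a₀₂ + b₁₁) * (b₀₂ - a₁₁) + b₀₂ * b₁₁)
              • (AngleFun.cos ^ 2 * AngleFun.sin ^ 4)
            + (-((a₀₂ + b₁₁) * a₀₂) + b₀₂ * (b₀₂ - a₁₁)) • (AngleFun.cos * AngleFun.sin ^ 5)
            + (-(a₀₂ * b₀₂)) • AngleFun.sin ^ 6) := by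
      rw [hk₁, hk₂, hl₁, hl₂]
      simp only [Algebra.smul_def, map_add, map_sub, map_mul, map_neg]
      ring
    rw [e, map_sub, ContinuousMap.sub_apply, AngleFun.integral_quartic, AngleFun.integral_sextic]
    ring

end GraphSystem

/-! ### The Liapunov number. -/

open Polynomial in
theorem proposition3p3 {V₁ V₂ : Type*} [Fintype V₁] [Fintype V₂]
    (G₁ : SimpleGraph V₁) (G₂ : SimpleGraph V₂)
    (hcard₁ : 2 ≤ Fintype.card V₁) (hcard₂ : 2 ≤ Fintype.card V₂)
    (hiso₁ : ∀ v, ¬ G₁.IsIsolated v) (hiso₂ : ∀ v, ¬ G₂.IsIsolated v) :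
    HasLiapunovNumber (graphField G₁ G₂ 0)
      (3 * Real.pi / 2 *
        (3 * (boundaryCoeff G₂ 0 3 : ℝ) + boundaryCoeff G₁ 1 2 + boundaryCoeff G₂ 2 1
          + 2 * boundaryCoeff G₁ 0 2 * boundaryCoeff G₂ 0 2
          + boundaryCoeff G₁ 1 1 * boundaryCoeff G₁ 0 2
          - boundaryCoeff G₂ 1 1 * boundaryCoeff G₂ 0 2)) := by
  have hF1 : ContDiff ℝ 1 (graphField G₁ G₂ 0) := contDiff_graphField 0
  obtain ⟨P, hP, hP0, hret, hexp⟩ := exists_return_map (hasPolarForm_graphField hiso₁ hiso₂)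
    (g₀ := AngleFun.cos * (polarBoundary G₁).coeff 0 + AngleFun.sin * (polarBoundary G₂).coeff 0)
    (g₁ := AngleFun.cos * (polarBoundary G₁).coeff 1 + AngleFun.sin * (polarBoundary G₂).coeff 1)
    (h₀ := AngleFun.cos * (polarBoundary G₂).coeff 0 - AngleFun.sin * (polarBoundary G₁).coeff 0)
    (by simp [radialPart]) (by simp [radialPart]) (by simp [angularPart])
  obtain ⟨hI0, hI1⟩ := integral_radial_coefficients _ _ _ _ _ _ _ _ _ _
    (polarBoundary_coeff_zero (G := G₁)) (polarBoundary_coeff_zero (G := G₂))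
    (polarBoundary_coeff_one (G := G₁)) (polarBoundary_coeff_one (G := G₂))
  -- The pattern splits off only the `2 * g₀ * I g₀` summand, so that `hI1` still matches the
  -- remaining integral.
  simp only [map_add _ (2 * _ * _ : AngleFun), ContinuousMap.add_apply,
    AngleFun.integralCLM_two_mul_self, hI0, hI1] at hexp
  set κ : ℝ := 3 * (boundaryCoeff G₂ 0 3 : ℝ) + boundaryCoeff G₁ 1 2 + boundaryCoeff G₂ 2 1
          + 2 * boundaryCoeff G₁ 0 2 * boundaryCoeff G₂ 0 2
          + boundaryCoeff G₁ 1 1 * boundaryCoeff G₁ 0 2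
          - boundaryCoeff G₂ 1 1 * boundaryCoeff G₂ 0 2
  have hPm : poincareMap (graphField G₁ G₂ 0) =ᶠ[𝓝 0] P := by
    have : ∀ᶠ s in 𝓝[≠] (0 : ℝ), poincareMap (graphField G₁ G₂ 0) s = P s :=
      hret.mono fun s hs => poincareMap_eq hF1 hs
    rw [eventually_nhdsWithin_iff] at this
    filter_upwards [this] with s hs
    rcases eq_or_ne s 0 with rfl | h
    · rw [poincareMap_zero, hP0]
    · exact hs h
  have hC : ContDiffAt ℝ 3 (poincareMap (graphField G₁ G₂ 0)) 0 := hP.congr_of_eventuallyEq hPm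
  have hD : ContDiffAt ℝ (3 : ℕ) (displacement (graphField G₁ G₂ 0)) 0 := hC.sub contDiffAt_id
  -- The `s²` coefficient is zero, so `d(s) = (π / 4) κ s³ + O(s⁴)`.
  have hlo : (fun s => displacement (graphField G₁ G₂ 0) s
      - (C (Real.pi / 4 * κ) * X ^ 3 : ℝ[X]).eval s) =o[𝓝 (0 : ℝ)] fun s => s ^ 3 := by
    refine (hexp.congr' ?_ EventuallyEq.rfl).trans_isLittleO
      (Asymptotics.isLittleO_pow_pow (by norm_num))
    filter_upwards [hPm] with s hs
    simp only [displacement, hs, eval_mul, eval_C, eval_pow, eval_X]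
    ring
  have hder : ∀ {k : ℕ}, k ≤ 3 → iteratedDeriv k (displacement (graphField G₁ G₂ 0)) 0
      = k.factorial * (C (Real.pi / 4 * κ) * X ^ 3 : ℝ[X]).coeff k := fun hk =>
    iteratedDeriv_eq_of_isLittleO hD (natDegree_C_mul_X_pow_le _ _) hlo hk
  simp only [coeff_C_mul_X_pow] at hder
  refine ⟨isLinearCenter_graphField hiso₁ hiso₂, ?_, hC, ?_, ?_, ?_, ?_⟩
  · exact hret.mono fun s hs => ⟨P s, hs, fun q hq => hq.unique hF1 hs⟩
  · rw [displacement, poincareMap_zero, sub_zero]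
  · have := hder (k := 1) (by norm_num)
    rw [iteratedDeriv_one] at this
    simpa using this
  · have := hder (k := 2) (by norm_num)
    simpa using this
  -- `3! * (π / 4) = 3 * π / 2`.
  · rw [hder le_rfl, if_pos rfl]
    simp only [Nat.factorial]
    push_cast
    ring
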